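/- Let $\Omega=(l,r)\subset\mathbb{R}$ be a bounded open interval, let $0<\alpha<1$, $\epsilon>0$, $T>0$, and let $0<c<C$, $L\ge 0$. Let $(\lambda_j,\varphi_j)_{j\ge 1}$ be the eigenvalues (in increasing order) and the $L^2(\Omega)$-normalized eigenfunctions of $A=-\Delta$ on $\Omega$ with homogeneous Dirichlet boundary conditions, and for $s\ge 0$ let $\dot H^s(\Omega)$ be the space of all $v\in L^2(\Omega)$ with $\|v\|_{\dot H^s(\Omega)}^2=\sum_{j\ge1}\lambda_j^s(v,\varphi_j)^2<\infty$. Let ${}_0I_t^\alpha W(t)=\frac1{\Gamma(\alpha)}\int_0^t (t-\xi)^{\alpha-1}W(\xi)\,d\xi$ and ${}_0D_t^{1-\alpha}W=\frac{\partial}{\partial t}\,{}_0I_t^{\alpha}W$. Then there is a constant $K>0$, depending only on $\Omega,\alpha,\epsilon,T,c,C,L$, such that the following holds. Let $a$ be a real function with $c<a^2(t)<C$ and $\left|\frac1{a^2(t)}-\frac1{a^2(s)}\right|\le L|t-s|$ for all $t,s\in[0,T]$. Let $W_0\in\dot H^\epsilon(\Omega)$, and let $f:[0,T]\to L^2(\Omega)$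 be absolutely continuous, i.e. $f(t)=f(0)+\int_0^t f'(s)\,ds$ with $f(0)\in L^2(\Omega)$ and $\int_0^T\|f'(s)\|_{L^2(\Omega)}\,ds<\infty$. Let $W$ be a weak solution of $$\frac{\partial W}{\partial t}=\frac1{a^2(t)}\,\Delta\left[{}_0D_t^{1-\alpha}W\right]+f\ \text{ in }\Omega\times(0,T],\qquad W(\cdot,0)=W_0\ \text{ in }\Omega,\qquad W=0\ \text{ on }\partial\Omega\times(0,T].$$ This means: $W\in C([0,T];L^2(\Omega))$ and $W(0)=W_0$; the function ${}_0I_t^\alpha W$ is locally absolutely continuous on $(0,T]$ with values in $L^2(\Omega)$, with derivative $G={}_0D_t^{1-\alpha}W$; and for every $v\in C^\infty(\overline\Omega)$ with $v=0$ on $\partial\Omega$ and all $0<\delta\le t\le T$, $$(W(t),v)-(W(\delta),v)=\int_\delta^t\Big(\frac1{a^2(s)}(G(s),v'')+(f(s),v)\Big)ds .$$ Then for every $t\in(0,T]$ one has $W(t)\in\dot H^2(\Omega)$ and $$\|W(t)\|_{\dot H^2(\Omega)}\le K\left(t^{-\alpha}\|W_0\|_{\dot H^\epsilon(\Omega)}+\|f(0)\|_{L^2(\Omega)}+\int_0^t\|f'(s)\|_{L^2(\Omega)}\,ds\right).$$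 -/

import Mathlib

namespace ExpandingMedia

open MeasureTheory

/-- The real Hilbert space `L²(Ω)` for the bounded one-dimensional domain `Ω = (l, r)`. -/
abbrev L2 (l r : ℝ) : Type := Lp ℝ 2 (volume.restrict (Set.Ioo l r))

/-- The `L²(Ω)` pairing `(v, g) = ∫_Ω v g dx` of `v ∈ L²(Ω)` with a function `g`. -/
noncomputable def pairing {l r : ℝ} (v : L2 l r) (g : ℝ → ℝ) : ℝ :=
  ∫ x in Set.Ioo l r, v x * g x

/-- `(μ, u)` is an eigenpair of `A = -Δ` on `Ω = (l, r)` with homogeneous Dirichlet boundary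
conditions, and `u` is normalized in `L²(Ω)`. -/
structure IsNormalizedDirichletEigenpair (l r μ : ℝ) (u : ℝ → ℝ) : Prop where
  contDiff : ContDiff ℝ 2 u
  eigen : ∀ x ∈ Set.Ioo l r, -deriv (deriv u) x = μ * u x
  left : u l = 0
  right : u r = 0
  normalized : ∫ x in Set.Ioo l r, u x ^ 2 = 1

/-- The eigenvalues of the Dirichlet operator `A = -Δ` on `(l, r)`, in increasing order; the index
`j = 0, 1, 2, …` stands for the `(j+1)`-st eigenvalue. -/
noncomputable def eigenvalue (l r : ℝ) (j : ℕ) : ℝ :=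
  (((j : ℝ) + 1) * Real.pi / (r - l)) ^ 2

/-- The corresponding eigenfunctions, normalized in `L²(l, r)`. -/
noncomputable def eigenfunction (l r : ℝ) (j : ℕ) (x : ℝ) : ℝ :=
  Real.sqrt (2 / (r - l)) * Real.sin (((j : ℝ) + 1) * Real.pi / (r - l) * (x - l))

theorem deriv_sinusoid (c k l : ℝ) :
    deriv (fun x : ℝ => c * Real.sin (k * (x - l))) =
      fun x => c * (k * Real.cos (k * (x - l))) := by
  funext x
  have h1 : HasDerivAt (fun x : ℝ => k * (x - l)) k x := by
    simpa using ((hasDerivAt_id x).sub_const l).const_mul k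
  have := (h1.sin.const_mul c).deriv
  rw [this]; ring

theorem deriv_deriv_sinusoid (c k l x : ℝ) :
    deriv (deriv (fun x : ℝ => c * Real.sin (k * (x - l)))) x =
      -(k ^ 2 * (c * Real.sin (k * (x - l)))) := by
  rw [deriv_sinusoid]
  have h1 : HasDerivAt (fun x : ℝ => k * (x - l)) k x := by
    simpa using ((hasDerivAt_id x).sub_const l).const_mul k
  have := ((h1.cos.const_mul k).const_mul c).deriv
  rw [this]; ring

theorem integral_sin_sq_of_node {l r k : ℝ} (hlr : l < r) (hk : k ≠ 0)
    (hs : Real.sin (k * (r - l)) = 0) :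
    ∫ x in Set.Ioo l r, Real.sin (k * (x - l)) ^ 2 = (r - l) / 2 := by
  rw [← integral_Ioc_eq_integral_Ioo, ← intervalIntegral.integral_of_le hlr.le]
  have h := intervalIntegral.integral_comp_mul_sub (a := l) (b := r)
    (fun y : ℝ => Real.sin y ^ 2) hk (k * l)
  simp only [← mul_sub] at h
  rw [h, integral_sin_sq, hs]
  simp
  field_simp

/-- The pairs `(eigenvalue l r j, eigenfunction l r j)` are normalized Dirichlet eigenpairs. -/
theorem isNormalizedDirichletEigenpair_eigenfunction {l r : ℝ} (hlr : l < r) (j : ℕ) :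
    IsNormalizedDirichletEigenpair l r (eigenvalue l r j) (eigenfunction l r j) := by
  have hd : 0 < r - l := sub_pos.2 hlr
  have hend : Real.sin (((j : ℝ) + 1) * Real.pi / (r - l) * (r - l)) = 0 := by
    rw [div_mul_cancel₀ _ hd.ne']
    exact_mod_cast Real.sin_nat_mul_pi (j + 1)
  have hk : ((j : ℝ) + 1) * Real.pi / (r - l) ≠ 0 := by positivity
  refine ⟨?_, ?_, ?_, ?_, ?_⟩
  · unfold eigenfunction
    fun_prop
  · intro x _
    have := deriv_deriv_sinusoid (Real.sqrt (2 / (r - l)))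
      (((j : ℝ) + 1) * Real.pi / (r - l)) l x
    unfold eigenfunction eigenvalue
    rw [this, neg_neg]
  · simp [eigenfunction]
  · simp only [eigenfunction, hend, mul_zero]
  · simp only [eigenfunction, mul_pow]
    rw [integral_const_mul, integral_sin_sq_of_node hlr hk hend, Real.sq_sqrt (by positivity)]
    field_simp

/-- Up to sign, there are no other normalized Dirichlet eigenpairs; in particular every eigenvalue
is simple. -/
theorem IsNormalizedDirichletEigenpair.eq_eigenfunction {l r μ : ℝ} (hlr : l < r) {u : ℝ → ℝ}
    (h : IsNormalizedDirichletEigenpair l r μ u) :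
    ∃ j : ℕ, μ = eigenvalue l r j ∧
      ((∀ x ∈ Set.Icc l r, u x = eigenfunction l r j x) ∨
        (∀ x ∈ Set.Icc l r, u x = -eigenfunction l r j x)) := by
  have hd : 0 < r - l := sub_pos.2 hlr
  have hu : ∀ x, HasDerivAt u (deriv u x) x := fun x =>
    (h.contDiff.differentiable (by norm_num) x).hasDerivAt
  have hcw : ContDiff ℝ 1 (deriv u) := by
    have := h.contDiff
    rw [show (2 : WithTop ℕ∞) = 1 + 1 by norm_num, contDiff_succ_iff_deriv] at this
    exact this.2.2
  have hw0 : ∀ x, HasDerivAt (deriv u) (deriv (deriv u) x) x := fun x =>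
    (hcw.differentiable (by norm_num) x).hasDerivAt
  have hode : ∀ x ∈ Set.Icc l r, deriv (deriv u) x = -(μ * u x) := by
    have hE : Set.EqOn (deriv (deriv u)) (fun x => -(μ * u x)) (Set.Ioo l r) := by
      intro x hx
      have := h.eigen x hx
      simp only
      linarith
    have h2 := hE.closure (hcw.continuous_deriv le_rfl)
      (by have := h.contDiff.continuous; fun_prop)
    rw [closure_Ioo hlr.ne] at h2
    exact h2
  have hw : ∀ x ∈ Set.Icc l r, HasDerivAt (deriv u) (-(μ * u x)) x := fun x hx => by
    rw [← hode x hx]; exact hw0 x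
  have hconst : ∀ g g' : ℝ → ℝ, (∀ x ∈ Set.Icc l r, HasDerivAt g (g' x) x) →
      (∀ x ∈ Set.Icc l r, g' x = 0) → ∀ x ∈ Set.Icc l r, g x = g l := by
    intro g g' hg hg0
    refine constant_of_has_deriv_right_zero
      (fun x hx => (hg x hx).continuousAt.continuousWithinAt) ?_
    intro x hx
    have := hg x ⟨hx.1, hx.2.le⟩
    rw [hg0 x ⟨hx.1, hx.2.le⟩] at this
    exact this.hasDerivWithinAt
  have hne : ¬ ∀ x ∈ Set.Icc l r, u x = 0 := by
    intro h0
    have h1 := h.normalized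
    rw [setIntegral_congr_fun (g := fun _ => (0 : ℝ)) measurableSet_Ioo
      (fun x hx => by simp [h0 x ⟨hx.1.le, hx.2.le⟩])] at h1
    simp at h1
  have hl : l ∈ Set.Icc l r := ⟨le_rfl, hlr.le⟩
  have hr : r ∈ Set.Icc l r := ⟨hlr.le, le_rfl⟩
  have hμ : 0 < μ := by
    by_contra hμ
    push Not at hμ
    apply hne
    have hmono : MonotoneOn (fun x => u x * deriv u x) (Set.Icc l r) := by
      apply monotoneOn_of_deriv_nonneg (convex_Icc l r)
      · exact fun x hx => ((hu x).mul (hw x hx)).continuousAt.continuousWithinAt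
      · exact fun x _ => ((hu x).mul (hw0 x)).differentiableAt.differentiableWithinAt
      · intro x hx
        rw [interior_Icc] at hx
        have := ((hu x).mul (hw x ⟨hx.1.le, hx.2.le⟩)).deriv
        rw [show (fun x => u x * deriv u x) = u * deriv u from rfl, this]
        nlinarith [mul_self_nonneg (deriv u x), mul_self_nonneg (u x)]
    have hz : ∀ x ∈ Set.Icc l r, u x * deriv u x = 0 := by
      intro x hx
      have h1 := hmono hl hx hx.1
      have h2 := hmono hx hr hx.2
      simp only [h.left, h.right, zero_mul] at h1 h2
      linarith
    have h3 := hconst (u * u) _ (fun x _ => (hu x).mul (hu x))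
      (fun x hx => by linarith [hz x hx])
    intro x hx
    have := h3 x hx
    simpa [h.left] using this
  obtain ⟨k, hk, rfl⟩ : ∃ k : ℝ, 0 < k ∧ μ = k ^ 2 :=
    ⟨Real.sqrt μ, Real.sqrt_pos.2 hμ, (Real.sq_sqrt hμ.le).symm⟩
  have hθ : ∀ x : ℝ, HasDerivAt (fun x : ℝ => k * (x - l)) k x := fun x => by
    simpa using ((hasDerivAt_id x).sub_const l).const_mul k
  have hP := hconst
    (fun x => k * u x * Real.cos (k * (x - l)) - deriv u x * Real.sin (k * (x - l))) _
    (fun x hx => (((hu x).const_mul k).mul (hθ x).cos).sub ((hw x hx).mul (hθ x).sin))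
    (fun x hx => by ring)
  have hQ := hconst
    (fun x => k * u x * Real.sin (k * (x - l)) + deriv u x * Real.cos (k * (x - l))) _
    (fun x hx => (((hu x).const_mul k).mul (hθ x).sin).add ((hw x hx).mul (hθ x).cos))
    (fun x hx => by ring)
  simp only [h.left, sub_self, mul_zero, Real.sin_zero, Real.cos_zero, mul_one, zero_add]
    at hP hQ
  obtain ⟨m, hm⟩ : ∃ m : ℝ, ∀ x ∈ Set.Icc l r, u x = m * Real.sin (k * (x - l)) := by
    refine ⟨deriv u l / k, fun x hx => ?_⟩
    have h1 := hP x hx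
    have h2 := hQ x hx
    have h3 := Real.sin_sq_add_cos_sq (k * (x - l))
    rw [div_mul_eq_mul_div, eq_div_iff hk.ne']
    linear_combination Real.cos (k * (x - l)) * h1 + Real.sin (k * (x - l)) * h2
      - k * u x * h3
  have hm0 : m ≠ 0 := by
    rintro rfl
    exact hne fun x hx => by simp [hm x hx]
  have hs : Real.sin (k * (r - l)) = 0 := by
    have := hm r hr
    rw [h.right] at this
    simpa [hm0] using this.symm
  have hkj : ∃ j : ℕ, k = ((j : ℝ) + 1) * Real.pi / (r - l) := by
    obtain ⟨n, hn⟩ := Real.sin_eq_zero_iff.1 hs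
    have hn0 : 0 < (n : ℝ) := by
      have : 0 < (n : ℝ) * Real.pi := by rw [hn]; positivity
      exact pos_of_mul_pos_left this Real.pi_pos.le
    have hn1 : 0 < n := by exact_mod_cast hn0
    obtain ⟨j, rfl⟩ : ∃ j : ℕ, n = (j : ℤ) + 1 := ⟨(n - 1).toNat, by omega⟩
    refine ⟨j, ?_⟩
    rw [eq_div_iff hd.ne', ← hn]
    push_cast
    ring
  obtain ⟨j, rfl⟩ := hkj
  have hm2 : m ^ 2 = Real.sqrt (2 / (r - l)) ^ 2 := by
    have h1 := h.normalized
    rw [setIntegral_congr_fun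
      (g := fun x => m ^ 2 * Real.sin (((j : ℝ) + 1) * Real.pi / (r - l) * (x - l)) ^ 2)
      measurableSet_Ioo (fun x hx => by simp only [hm x ⟨hx.1.le, hx.2.le⟩, mul_pow]),
      integral_const_mul, integral_sin_sq_of_node hlr hk.ne' hs] at h1
    rw [Real.sq_sqrt (by positivity), eq_div_iff hd.ne']
    linarith
  refine ⟨j, rfl, ?_⟩
  rcases sq_eq_sq_iff_eq_or_eq_neg.1 hm2 with hm3 | hm3
  · exact Or.inl fun x hx => by rw [hm x hx, hm3, eigenfunction]
  · exact Or.inr fun x hx => by rw [hm x hx, hm3, eigenfunction]; ring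

/-- The space `Ḣ^s(Ω) = {v ∈ L²(Ω) : A^{s/2} v ∈ L²(Ω)}`. -/
def HDot (l r s : ℝ) : Set (L2 l r) :=
  {v | Summable fun j : ℕ => eigenvalue l r j ^ s * pairing v (eigenfunction l r j) ^ 2}

/-- The norm `‖v‖_{Ḣ^s(Ω)} = (∑ⱼ λⱼ^s (v, φⱼ)²)^{1/2}` (meaningful for `v ∈ Ḣ^s(Ω)`). -/
noncomputable def hDotNorm {l r : ℝ} (s : ℝ) (v : L2 l r) : ℝ :=
  Real.sqrt (∑' j : ℕ, eigenvalue l r j ^ s * pairing v (eigenfunction l r j) ^ 2)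

/-- The Riemann–Liouville fractional integral
`₀I_t^α W(t) = Γ(α)⁻¹ ∫₀ᵗ (t - ξ)^{α-1} W(ξ) dξ`, as a Bochner integral in `L²(Ω)`. -/
noncomputable def rlIntegral {l r : ℝ} (α : ℝ) (W : ℝ → L2 l r) (t : ℝ) : L2 l r :=
  (Real.Gamma α)⁻¹ • ∫ ξ in (0 : ℝ)..t, (t - ξ) ^ (α - 1) • W ξ

/-- `G` is the Riemann–Liouville derivative `₀D_t^{1-α} W = ∂ₜ ₀I_t^α W` on `(0, T]`: the function
`₀I_t^α W` is locally absolutely continuous on `(0, T]` with derivative `G`. -/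
def IsRLDeriv {l r : ℝ} (α T : ℝ) (W G : ℝ → L2 l r) : Prop :=
  ∀ δ t : ℝ, 0 < δ → δ ≤ t → t ≤ T →
    IntervalIntegrable G volume δ t ∧
      rlIntegral α W t - rlIntegral α W δ = ∫ s in δ..t, G s

/-- `W` solves `∂ₜ W = a(t)⁻² Δ (₀D_t^{1-α} W) + f` in `(l, r) × (0, T]` with `W(0) = W₀` and
homogeneous Dirichlet boundary conditions, in the weak sense: `W ∈ C([0, T]; L²(Ω))`,
`G = ₀D_t^{1-α} W` exists on `(0, T]`, and the equation, integrated in time, holds when tested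
with every `v` that is smooth up to the boundary and vanishes on the boundary (both integrations
by parts in space fall on `v`, which builds in the boundary condition). -/
structure IsSolution {l r : ℝ} (α T : ℝ) (a : ℝ → ℝ) (W₀ : L2 l r) (f W : ℝ → L2 l r) :
    Prop where
  continuousOn : ContinuousOn W (Set.Icc 0 T)
  initial : W 0 = W₀
  equation : ∃ G : ℝ → L2 l r, IsRLDeriv α T W G ∧
    ∀ v : ℝ → ℝ, ContDiff ℝ (⊤ : ℕ∞) v → v l = 0 → v r = 0 →
      ∀ δ t : ℝ, 0 < δ → δ ≤ t → t ≤ T →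
        pairing (W t) v - pairing (W δ) v =
          ∫ s in δ..t, (1 / a s ^ 2 * pairing (G s) (deriv (deriv v)) + pairing (f s) v)

end ExpandingMedia

namespace ExpandingMedia

open MeasureTheory Filter Topology

/-! Testing with the eigenfunctions decouples the problem: `w = (W, φⱼ)` satisfies, in integrated
form, `w' = -λⱼ b (I^α w)' + F` with `b = 1 / a²` and `F = (f, φⱼ)`. Over a short interval `[t - h,
t]` the Lipschitz bound lets `b` be frozen at `t` with an error `o(h)`, so `w` and `-w` are
subsolutions of a scalar inequality for increments (`isScalarSubsolution_of_integral_eq`). This form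
needs no differentiability of `w`.

Such subsolutions obey a maximum principle (`nonpos_of_subsolution`) and can be compared with
barriers `x + A t^(-β)`, `0 < β < α`. The convolution of `t^(-β)` with the kernel is a multiple of
`t^(α-β)`, which increases; after a time of order `λⱼ^(-1/α)` this growth outweighs the decrease of
`t^(-β)`, and before that time a uniform bound suffices. The outcome
(`IsScalarSubsolution.le_decay`) is decay of the initial part like `λⱼ^(-β/α) t^(-β) |w(0)|`, plus a
source part of order `λⱼ⁻¹ sup |F|`.

For `ε ≤ 1` the choice `β = α (1 - ε/2)` makes `λⱼ |w(t)|` at most a constant times `t^(-α) λⱼ^(ε/2)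
|w(0)| + sup |F|`; the margin `ε` pays for `β < α`. Squaring and summing over `j`, with Bessel's and
Minkowski's inequalities for the source, gives the `Ḣ²` bound. -/

/-! ### Maximum principle for the power-kernel convolution -/

/-- The convolution `∫₀ᵗ (t - ξ)^{α-1} v(ξ) dξ`, that is, `Γ(α)` times the Riemann–Liouville
integral of the scalar function `v`. -/
noncomputable def powerConv (α : ℝ) (v : ℝ → ℝ) (t : ℝ) : ℝ :=
  ∫ ξ in (0 : ℝ)..t, (t - ξ) ^ (α - 1) * v ξ

theorem mul_rpow_sub_one_le_rpow_sub_rpow {α t h : ℝ} (hα0 : 0 ≤ α) (hα1 : α ≤ 1) (ht : 0 < t)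
    (hht : h ≤ t) : α * (h * t ^ (α - 1)) ≤ t ^ α - (t - h) ^ α := by
  have h1 : (1 + -(h / t)) ^ α ≤ 1 + α * (-(h / t)) :=
    rpow_one_add_le_one_add_mul_self (by
      have : h / t ≤ 1 := (div_le_one ht).2 hht
      linarith) hα0 hα1
  have h2 : (t - h) ^ α = t ^ α * (1 + -(h / t)) ^ α := by
    rw [← Real.mul_rpow ht.le (by
      have : h / t ≤ 1 := (div_le_one ht).2 hht
      linarith)]
    congr 1
    field_simp
    ring
  have h3 : t ^ (α - 1) = t ^ α / t := Real.rpow_sub_one ht.ne' α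
  have h4 : 0 ≤ t ^ α := Real.rpow_nonneg ht.le α
  rw [h2, h3]
  have h5 := mul_le_mul_of_nonneg_left h1 h4
  have h6 : t ^ α * (1 + α * (-(h / t))) = t ^ α - α * (h * (t ^ α / t)) := by ring
  linarith

theorem intervalIntegrable_sub_rpow {α : ℝ} (hα : 0 < α) (t a b : ℝ) :
    IntervalIntegrable (fun ξ : ℝ => (t - ξ) ^ (α - 1)) volume a b := by
  have := (intervalIntegral.intervalIntegrable_rpow' (a := t - a) (b := t - b)
    (r := α - 1) (by linarith)).comp_sub_left t
  simpa using this

theorem integral_sub_rpow {α : ℝ} (hα : 0 < α) (s t : ℝ) :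
    ∫ ξ in s..t, (t - ξ) ^ (α - 1) = (t - s) ^ α / α := by
  rw [intervalIntegral.integral_comp_sub_left (fun x : ℝ => x ^ (α - 1)) t,
    integral_rpow (Or.inl (by linarith))]
  simp [Real.zero_rpow hα.ne']

theorem powerConv_const {α : ℝ} (hα : 0 < α) (m t : ℝ) :
    powerConv α (fun _ => m) t = t ^ α / α * m := by
  rw [powerConv, intervalIntegral.integral_mul_const, integral_sub_rpow hα, sub_zero]

theorem powerConv_sub {α t : ℝ} {v z : ℝ → ℝ}
    (hv : IntervalIntegrable (fun ξ => (t - ξ) ^ (α - 1) * v ξ) volume 0 t)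
    (hz : IntervalIntegrable (fun ξ => (t - ξ) ^ (α - 1) * z ξ) volume 0 t) :
    powerConv α (fun ξ => v ξ - z ξ) t = powerConv α v t - powerConv α z t := by
  simp only [powerConv, mul_sub]
  exact intervalIntegral.integral_sub hv hz

/-- The constant `x` has an explicit convolution, and `x - v` is nonnegative. Since `(t - ξ)^(α-1)`
decreases in `t`, the history of `x - v` on `(0, t - h)` weighs less at time `t` than at time `t -
h`; only the new piece on `[t - h, t]` counts against the increment. -/
theorem le_powerConv_sub_powerConv {α t h x : ℝ} (hα0 : 0 < α) (hα1 : α < 1) (hh : 0 < h)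
    (hht : h < t) (hx : 0 ≤ x) {v : ℝ → ℝ}
    (hint : ∀ s ∈ Set.Ioc 0 t, IntervalIntegrable (fun ξ => (s - ξ) ^ (α - 1) * v ξ) volume 0 s)
    (hvx : ∀ ξ ∈ Set.Ioc 0 t, v ξ ≤ x) :
    x * (h * t ^ (α - 1)) - ∫ ξ in (t - h)..t, (t - ξ) ^ (α - 1) * (x - v ξ) ≤
      powerConv α v t - powerConv α v (t - h) := by
  have ht : 0 < t := hh.trans hht
  have hc : ∀ s a b : ℝ, IntervalIntegrable (fun ξ => (s - ξ) ^ (α - 1) * x) volume a b :=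
    fun s a b => (intervalIntegrable_sub_rpow hα0 s a b).mul_const x
  have hy : ∀ s ∈ Set.Ioc 0 t,
      IntervalIntegrable (fun ξ => (s - ξ) ^ (α - 1) * (x - v ξ)) volume 0 s := by
    intro s hs
    simpa only [mul_sub] using (hc s 0 s).sub (hint s hs)
  have hpc : ∀ s ∈ Set.Ioc 0 t, powerConv α v s =
      s ^ α / α * x - ∫ ξ in (0 : ℝ)..s, (s - ξ) ^ (α - 1) * (x - v ξ) := by
    intro s hs
    have h1 := powerConv_sub (hc s 0 s) (hint s hs)
    rw [powerConv_const hα0 x s] at h1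
    rw [powerConv] at h1
    linarith
  have hs1 : t ∈ Set.Ioc 0 t := ⟨ht, le_rfl⟩
  have hs2 : t - h ∈ Set.Ioc 0 t := ⟨by linarith, by linarith⟩
  have hsub1 : IntervalIntegrable (fun ξ => (t - ξ) ^ (α - 1) * (x - v ξ)) volume 0 (t - h) :=
    (hy t hs1).mono_set (by
      rw [Set.uIcc_of_le (by linarith), Set.uIcc_of_le ht.le]
      exact Set.Icc_subset_Icc le_rfl (by linarith))
  have hsub2 : IntervalIntegrable (fun ξ => (t - ξ) ^ (α - 1) * (x - v ξ)) volume (t - h) t :=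
    (hy t hs1).mono_set (by
      rw [Set.uIcc_of_le (by linarith), Set.uIcc_of_le ht.le]
      exact Set.Icc_subset_Icc (by linarith) le_rfl)
  have hsplit := intervalIntegral.integral_add_adjacent_intervals hsub1 hsub2
  have hmono : ∫ ξ in (0 : ℝ)..(t - h), (t - ξ) ^ (α - 1) * (x - v ξ) ≤
      ∫ ξ in (0 : ℝ)..(t - h), (t - h - ξ) ^ (α - 1) * (x - v ξ) := by
    refine intervalIntegral.integral_mono_on_of_le_Ioo (by linarith) hsub1 (hy _ hs2) ?_
    intro ξ hξ
    refine mul_le_mul_of_nonneg_right ?_ (sub_nonneg.2 (hvx ξ ⟨hξ.1, by linarith [hξ.2]⟩))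
    exact Real.rpow_le_rpow_of_nonpos (by linarith [hξ.2]) (by linarith) (by linarith)
  have hb := mul_rpow_sub_one_le_rpow_sub_rpow hα0.le hα1.le ht hht.le
  have hb2 : h * t ^ (α - 1) ≤ t ^ α / α - (t - h) ^ α / α := by
    rw [← sub_div, le_div_iff₀ hα0]
    linarith
  have hb3 := mul_le_mul_of_nonneg_left hb2 hx
  rw [hpc t hs1, hpc _ hs2, ← hsplit]
  linarith

/-- At a positive maximum `t` the convolution grows at rate at least `v t * t ^ (α - 1)`, up to the
new piece on `[t - h, t]`, while `v` would have to drop accordingly. The new piece is absorbed by a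
suitable choice of `h`. Continuity is asked only on `[δ, T]` because `v` will contain a barrier
singular at `0`. -/
theorem nonpos_of_subsolution {α δ T : ℝ} {v μ : ℝ → ℝ} (hα0 : 0 < α) (hα1 : α < 1) (hδ : 0 < δ)
    (hv : ContinuousOn v (Set.Icc δ T)) (hneg : ∀ t ∈ Set.Ioc 0 δ, v t ≤ 0)
    (hint : ∀ t ∈ Set.Ioc 0 T,
      IntervalIntegrable (fun ξ => (t - ξ) ^ (α - 1) * v ξ) volume 0 t)
    (hμ : ∀ t ∈ Set.Ioc δ T, 0 < μ t)
    (hsub : ∀ t ∈ Set.Ioc δ T, ∀ η > 0, ∀ᶠ h in 𝓝[>] (0 : ℝ),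
      v t - v (t - h) ≤ -(μ t * (powerConv α v t - powerConv α v (t - h))) + η * h) :
    ∀ t ∈ Set.Icc δ T, v t ≤ 0 := by
  intro t₀ ht₀
  by_contra! hpos
  obtain ⟨t, htI, hmax⟩ := isCompact_Icc.exists_isMaxOn ⟨t₀, ht₀⟩ hv
  have hvt : 0 < v t := hpos.trans_le (hmax ht₀)
  have htδ : δ < t := by
    by_contra! hle
    exact absurd (hneg t ⟨hδ.trans_le htI.1, hle⟩) (not_le.2 hvt)
  have ht : t ∈ Set.Ioc δ T := ⟨htδ, htI.2⟩
  have ht0 : 0 < t := hδ.trans htδ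
  have hle : ∀ ξ ∈ Set.Ioc 0 t, v ξ ≤ v t := by
    intro ξ hξ
    rcases le_total ξ δ with h | h
    · exact (hneg ξ ⟨hξ.1, h⟩).trans hvt.le
    · exact hmax ⟨h, hξ.2.trans htI.2⟩
  have hμt := hμ t ht
  have hk : 0 < t ^ (α - 1) := Real.rpow_pos_of_pos ht0 _
  -- Half of the guaranteed gain per unit of `h`, so that the error `η * h` cannot cancel it.
  set η : ℝ := μ t * (v t * t ^ (α - 1)) / 2 with hη
  have hηpos : 0 < η := by positivity
  have hsmall : ∀ᶠ h in 𝓝[>] (0 : ℝ), μ t * (h ^ α / α) ≤ 1 := by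
    have : Tendsto (fun h : ℝ => μ t * (h ^ α / α)) (𝓝[>] 0) (𝓝 (μ t * (0 ^ α / α))) := by
      refine tendsto_nhdsWithin_of_tendsto_nhds ?_
      exact ((Real.continuousAt_rpow_const 0 α (Or.inr hα0.le)).tendsto.div_const α).const_mul _
    rw [Real.zero_rpow hα0.ne', zero_div, mul_zero] at this
    exact (this.eventually (gt_mem_nhds one_pos)).mono fun h hh => hh.le
  have hball := (hsub t ht η hηpos).and
    (hsmall.and (Ioo_mem_nhdsGT (show (0 : ℝ) < t - δ by linarith)))
  obtain ⟨h₁, hh₁pos, hh₁⟩ := mem_nhdsGT_iff_exists_Ioc_subset.1 hball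
  rw [Set.mem_Ioi] at hh₁pos
  have hh₁δ : h₁ < t - δ := (hh₁ ⟨hh₁pos, le_rfl⟩).2.2.2
  have hcont : ContinuousOn v (Set.Icc (t - h₁) t) :=
    hv.mono (Set.Icc_subset_Icc (by linarith) htI.2)
  obtain ⟨ξ₀, hξ₀, hmin⟩ := isCompact_Icc.exists_isMinOn
    (Set.nonempty_Icc.2 (show t - h₁ ≤ t by linarith)) hcont
  -- With `t - h` a minimizer of `v` on `[t - h₁, t]`, the drop `v t - v ξ` on the new piece is at
  -- most `m = v t - v (t - h)`, so that piece is at most `h ^ α / α * m`. If the minimizer found is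
  -- `t` itself, `v` is constant there and `h = h₁` serves.
  obtain ⟨h, hh, hhm⟩ : ∃ h ∈ Set.Ioc 0 h₁, ∀ ξ ∈ Set.Icc (t - h₁) t, v (t - h) ≤ v ξ := by
    rcases eq_or_lt_of_le hξ₀.2 with heq | hlt
    · refine ⟨h₁, ⟨hh₁pos, le_rfl⟩, fun ξ hξ => ?_⟩
      have h1 : v (t - h₁) ≤ v t := hle _ ⟨by linarith, by linarith⟩
      have h2 : v ξ₀ ≤ v ξ := hmin hξ
      rw [heq] at h2
      exact h1.trans h2
    · refine ⟨t - ξ₀, ⟨by linarith, by linarith [hξ₀.1]⟩, fun ξ hξ => ?_⟩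
      rw [sub_sub_cancel]
      exact hmin hξ
  obtain ⟨hineq, hsm, -⟩ := hh₁ hh
  have hht : h < t := by linarith [hh.2]
  have hinc := le_powerConv_sub_powerConv hα0 hα1 hh.1 hht hvt.le
    (fun s hs => hint s ⟨hs.1, hs.2.trans htI.2⟩) hle
  set m := v t - v (t - h) with hm
  have hm0 : 0 ≤ m := sub_nonneg.2 (hle _ ⟨by linarith, by linarith [hh.1]⟩)
  have hrem : ∫ ξ in (t - h)..t, (t - ξ) ^ (α - 1) * (v t - v ξ) ≤ h ^ α / α * m := by
    have hci : IntervalIntegrable (fun ξ => (t - ξ) ^ (α - 1) * (v t - v ξ)) volume (t - h) t := by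
      refine (intervalIntegrable_sub_rpow hα0 t _ _).mul_continuousOn ?_
      rw [Set.uIcc_of_le (by linarith [hh.1])]
      exact continuousOn_const.sub
        (hcont.mono (Set.Icc_subset_Icc (by linarith [hh.2]) le_rfl))
    calc ∫ ξ in (t - h)..t, (t - ξ) ^ (α - 1) * (v t - v ξ)
        ≤ ∫ ξ in (t - h)..t, (t - ξ) ^ (α - 1) * m := by
          refine intervalIntegral.integral_mono_on (by linarith [hh.1]) hci
            ((intervalIntegrable_sub_rpow hα0 t _ _).mul_const m) fun ξ hξ => ?_
          refine mul_le_mul_of_nonneg_left ?_ (Real.rpow_nonneg (by linarith [hξ.2]) _)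
          have := hhm ξ ⟨by linarith [hξ.1, hh.2], hξ.2⟩
          linarith
      _ = h ^ α / α * m := by
          rw [intervalIntegral.integral_mul_const, integral_sub_rpow hα0, sub_sub_cancel]
  have h1 := mul_le_mul_of_nonneg_left hinc hμt.le
  have h2 := mul_le_mul_of_nonneg_left hrem hμt.le
  have h3 : μ t * (h ^ α / α * m) ≤ m := by
    rw [← mul_assoc]
    exact mul_le_of_le_one_left hm0 hsm
  have h4 : μ t * (v t * (h * t ^ (α - 1))) = 2 * η * h := by rw [hη]; ring
  have h5 : 0 < η * h := mul_pos hηpos hh.1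
  rw [mul_sub, h4] at h1
  linarith

/-! ### Convolutions of powers -/

/-- The value at time one of the convolution of `ξ ↦ ξ^{-β}` with the kernel `ξ ↦ ξ^{α-1}`. -/
noncomputable def powerConvRpow (α β : ℝ) : ℝ :=
  powerConv α (fun ξ => ξ ^ (-β)) 1

theorem intervalIntegrable_one_sub_rpow_mul_rpow {α β : ℝ} (hα : 0 < α) (hβ : β < 1) :
    IntervalIntegrable (fun u : ℝ => (1 - u) ^ (α - 1) * u ^ (-β)) volume 0 1 := by
  -- Splitting at `1 / 2` separates the two endpoint singularities.
  have h1 : IntervalIntegrable (fun u : ℝ => (1 - u) ^ (α - 1) * u ^ (-β)) volume 0 (1 / 2) := by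
    refine (intervalIntegral.intervalIntegrable_rpow' (by linarith)).continuousOn_mul ?_
    rw [Set.uIcc_of_le (by norm_num)]
    intro u hu
    exact ((continuousAt_const.sub continuousAt_id).rpow_const
      (Or.inl (sub_pos.2 (hu.2.trans_lt (by norm_num))).ne')).continuousWithinAt
  have h2 : IntervalIntegrable (fun u : ℝ => (1 - u) ^ (α - 1) * u ^ (-β)) volume (1 / 2) 1 := by
    refine (intervalIntegrable_sub_rpow hα 1 _ _).mul_continuousOn ?_
    rw [Set.uIcc_of_le (by norm_num)]
    intro u hu
    exact (continuousAt_id.rpow_const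
      (Or.inl (lt_of_lt_of_le (by norm_num) hu.1).ne')).continuousWithinAt
  exact h1.trans h2

theorem powerConvRpow_pos {α β : ℝ} (hα : 0 < α) (hβ : β < 1) : 0 < powerConvRpow α β := by
  refine intervalIntegral.intervalIntegral_pos_of_pos_on
    (intervalIntegrable_one_sub_rpow_mul_rpow hα hβ) (fun u hu => ?_) one_pos
  exact mul_pos (Real.rpow_pos_of_pos (by linarith [hu.2]) _) (Real.rpow_pos_of_pos hu.1 _)

theorem sub_mul_rpow_mul_mul_rpow {α β t u : ℝ} (ht : 0 < t) (hu : u ∈ Set.Icc (0 : ℝ) 1) :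
    (t - t * u) ^ (α - 1) * (t * u) ^ (-β) =
      t ^ (α - 1 - β) * ((1 - u) ^ (α - 1) * u ^ (-β)) := by
  rw [show t - t * u = t * (1 - u) by ring, Real.mul_rpow ht.le (by linarith [hu.2]),
    Real.mul_rpow ht.le hu.1, sub_eq_add_neg (α - 1) β, Real.rpow_add ht]
  ring

theorem intervalIntegrable_sub_rpow_mul_rpow {α β t : ℝ} (hα : 0 < α) (hβ : β < 1) (ht : 0 < t) :
    IntervalIntegrable (fun ξ : ℝ => (t - ξ) ^ (α - 1) * ξ ^ (-β)) volume 0 t := by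
  have h := intervalIntegrable_one_sub_rpow_mul_rpow hα hβ
  have h2 : IntervalIntegrable (fun u : ℝ => (t - t * u) ^ (α - 1) * (t * u) ^ (-β)) volume
      (0 / t) (t / t) := by
    rw [zero_div, div_self ht.ne']
    refine (h.const_mul (t ^ (α - 1 - β))).congr fun u hu => ?_
    rw [Set.uIoc_of_le zero_le_one] at hu
    exact (sub_mul_rpow_mul_mul_rpow ht ⟨hu.1.le, hu.2⟩).symm
  exact (IntervalIntegrable.comp_mul_left_iff
    (f := fun ξ : ℝ => (t - ξ) ^ (α - 1) * ξ ^ (-β)) ht.ne').1 h2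

/-- Homogeneity of kernel and power under the substitution `ξ = t * u`. -/
theorem powerConv_rpow {α t : ℝ} (β : ℝ) (ht : 0 < t) :
    powerConv α (fun ξ => ξ ^ (-β)) t = powerConvRpow α β * t ^ (α - β) := by
  have h := intervalIntegral.smul_integral_comp_mul_left (a := 0) (b := 1)
    (fun ξ : ℝ => (t - ξ) ^ (α - 1) * ξ ^ (-β)) t
  rw [mul_zero, mul_one] at h
  rw [powerConv, ← h, powerConvRpow, powerConv, intervalIntegral.integral_congr
    (g := fun u => t ^ (α - 1 - β) * ((1 - u) ^ (α - 1) * u ^ (-β))) fun u hu => by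
      rw [Set.uIcc_of_le zero_le_one] at hu
      exact sub_mul_rpow_mul_mul_rpow ht hu,
    intervalIntegral.integral_const_mul, smul_eq_mul, ← mul_assoc, mul_comm]
  congr 1
  rw [show α - β = 1 + (α - 1 - β) by ring, Real.rpow_add ht, Real.rpow_one]

theorem eventually_neg_mul_le_sub_of_hasDerivAt {ψ : ℝ → ℝ} {d t : ℝ} (h : HasDerivAt ψ d t)
    (hd : 0 ≤ d) {η : ℝ} (hη : 0 < η) :
    ∀ᶠ s in 𝓝[>] (0 : ℝ), -(η * s) ≤ ψ t - ψ (t - s) := by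
  have h1 := (hasDerivAt_iff_isLittleO.1 h).def hη
  have h2 : Tendsto (fun s : ℝ => t - s) (𝓝[>] 0) (𝓝 t) := by
    refine tendsto_nhdsWithin_of_tendsto_nhds ?_
    have : Tendsto (fun s : ℝ => t - s) (𝓝 0) (𝓝 (t - 0)) := (by fun_prop : Continuous _).tendsto 0
    rwa [sub_zero] at this
  filter_upwards [h2.eventually h1, self_mem_nhdsWithin] with s hs hs0
  rw [Set.mem_Ioi] at hs0
  simp only [sub_sub_cancel_left, smul_eq_mul, Real.norm_eq_abs, abs_neg, abs_of_pos hs0] at hs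
  have h3 := (abs_le.1 hs).2
  nlinarith

/-! ### Barriers and decay for scalar subsolutions -/

/-- The scalar function `w` is, with respect to the coefficient `μ`, a subsolution of
`w' = -μ (t^{α-1} * w)' + M` on `(0, T]`, up to errors that are small with the time step. -/
structure IsScalarSubsolution (α T M : ℝ) (μ w : ℝ → ℝ) : Prop where
  continuousOn : ContinuousOn w (Set.Icc 0 T)
  eventually_le : ∀ t ∈ Set.Ioc 0 T, ∀ η > 0, ∀ᶠ h in 𝓝[>] (0 : ℝ),
    w t - w (t - h) ≤ -(μ t * (powerConv α w t - powerConv α w (t - h))) + (M + η) * h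

/-- The maximum principle applied to `w` minus the barrier. The expression in `hbar` is the rate of
barrier plus `μ` times its convolution, minus the source, with `μ` frozen at the current time. -/
theorem IsScalarSubsolution.le_barrier {α β δ T M A x : ℝ} {μ w : ℝ → ℝ}
    (hw : IsScalarSubsolution α T M μ w) (hα0 : 0 < α) (hα1 : α < 1) (hβ1 : β < 1) (hδ : 0 < δ)
    (hμ : ∀ t ∈ Set.Ioc 0 T, 0 < μ t)
    (hinit : ∀ t ∈ Set.Ioc 0 T, t ≤ δ → w t ≤ x + A * t ^ (-β))
    (hbar : ∀ t ∈ Set.Ioc 0 T, δ < t → 0 ≤ A * (-β * t ^ (-β - 1)) + μ t * x * t ^ (α - 1) +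
      μ t * (A * powerConvRpow α β) * ((α - β) * t ^ (α - β - 1)) - M) :
    ∀ t ∈ Set.Ioc 0 T, w t ≤ x + A * t ^ (-β) := by
  intro t ht
  rcases le_or_gt t δ with htδ | htδ
  · exact hinit t ht htδ
  have hwi : ∀ s ∈ Set.Ioc 0 T,
      IntervalIntegrable (fun ξ => (s - ξ) ^ (α - 1) * w ξ) volume 0 s := fun s hs =>
    (intervalIntegrable_sub_rpow hα0 s _ _).mul_continuousOn (by
      rw [Set.uIcc_of_le hs.1.le]
      exact hw.continuousOn.mono (Set.Icc_subset_Icc le_rfl hs.2))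
  have hci : ∀ s : ℝ, IntervalIntegrable (fun ξ => (s - ξ) ^ (α - 1) * x) volume 0 s :=
    fun s => (intervalIntegrable_sub_rpow hα0 s _ _).mul_const x
  have hpi : ∀ s ∈ Set.Ioc 0 T,
      IntervalIntegrable (fun ξ => (s - ξ) ^ (α - 1) * (A * ξ ^ (-β))) volume 0 s := by
    intro s hs
    simpa only [mul_left_comm] using
      (intervalIntegrable_sub_rpow_mul_rpow hα0 hβ1 hs.1).const_mul A
  have hwci : ∀ s ∈ Set.Ioc 0 T,
      IntervalIntegrable (fun ξ => (s - ξ) ^ (α - 1) * (w ξ - x)) volume 0 s := by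
    intro s hs
    simpa only [mul_sub] using (hwi s hs).sub (hci s)
  have hpc : ∀ s ∈ Set.Ioc 0 T, powerConv α (fun ξ => w ξ - x - A * ξ ^ (-β)) s =
      powerConv α w s - s ^ α / α * x - A * powerConvRpow α β * s ^ (α - β) := by
    intro s hs
    rw [powerConv_sub (hwci s hs) (hpi s hs), powerConv_sub (hwi s hs) (hci s),
      powerConv_const hα0, mul_assoc, ← powerConv_rpow β hs.1, powerConv, powerConv, powerConv,
      ← intervalIntegral.integral_const_mul]
    simp only [mul_left_comm]
  have key := nonpos_of_subsolution (v := fun ξ => w ξ - x - A * ξ ^ (-β)) (μ := μ) (T := T)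
    hα0 hα1 hδ ?_ ?_ ?_ (fun s hs => hμ s ⟨hδ.trans hs.1, hs.2⟩) ?_ t ⟨htδ.le, ht.2⟩
  · linarith
  · refine ((hw.continuousOn.mono (Set.Icc_subset_Icc hδ.le le_rfl)).sub
      continuousOn_const).sub (continuousOn_const.mul ?_)
    exact fun ξ hξ => (Real.continuousAt_rpow_const ξ _
      (Or.inl (hδ.trans_le hξ.1).ne')).continuousWithinAt
  · intro s hs
    have := hinit s ⟨hs.1, (hs.2.trans_lt htδ).le.trans ht.2⟩ hs.2
    linarith
  · intro s hs
    simpa only [mul_sub] using (hwci s hs).sub (hpi s hs)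
  · intro s hs η hη
    have hs0 : 0 < s := hδ.trans hs.1
    have hsI : s ∈ Set.Ioc 0 T := ⟨hs0, hs.2⟩
    have hd := hbar s hsI hs.1
    have hder : HasDerivAt (fun y : ℝ => A * y ^ (-β) + μ s * x * (y ^ α / α) +
        μ s * (A * powerConvRpow α β) * y ^ (α - β) - M * y)
        (A * (-β * s ^ (-β - 1)) + μ s * x * s ^ (α - 1) +
          μ s * (A * powerConvRpow α β) * ((α - β) * s ^ (α - β - 1)) - M) s := by
      have e1 := (Real.hasDerivAt_rpow_const (p := -β) (Or.inl hs0.ne')).const_mul A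
      have e2 := ((Real.hasDerivAt_rpow_const (p := α) (Or.inl hs0.ne')).div_const α).const_mul
        (μ s * x)
      have e3 := (Real.hasDerivAt_rpow_const (p := α - β) (Or.inl hs0.ne')).const_mul
        (μ s * (A * powerConvRpow α β))
      have e4 := (hasDerivAt_id s).const_mul M
      rw [mul_div_cancel_left₀ _ hα0.ne'] at e2
      rw [mul_one] at e4
      exact ((e1.add e2).add e3).sub e4
    filter_upwards [hw.eventually_le s hsI (η / 2) (by positivity),
      eventually_neg_mul_le_sub_of_hasDerivAt hder hd (show 0 < η / 2 by positivity),
      Ioo_mem_nhdsGT hs0] with h h1 h2 h3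
    rw [hpc s hsI, hpc (s - h) ⟨by linarith [h3.2], by linarith [h3.1, hs.2]⟩]
    linarith

/-- The uniform bound: constants are supersolutions. -/
theorem IsScalarSubsolution.le_const {α T M μ₀ : ℝ} {μ w : ℝ → ℝ}
    (hw : IsScalarSubsolution α T M μ w) (hα0 : 0 < α) (hα1 : α < 1) (hM : 0 ≤ M) (hμ₀ : 0 < μ₀)
    (hμ : ∀ t ∈ Set.Ioc 0 T, μ₀ ≤ μ t) :
    ∀ t ∈ Set.Ioc 0 T, w t ≤ |w 0| + M * T ^ (1 - α) / μ₀ := by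
  intro t ht
  have hT : 0 < T := ht.1.trans_le ht.2
  have hTα : 0 < T ^ (1 - α) := Real.rpow_pos_of_pos hT _
  refine le_of_forall_pos_le_add fun η hη => ?_
  have hm : 0 ≤ M * T ^ (1 - α) / μ₀ := by positivity
  obtain ⟨δ, hδ, hδw⟩ : ∃ δ > 0, ∀ s ∈ Set.Ioc 0 T, s ≤ δ → w s ≤ |w 0| + η := by
    have h1 := hw.continuousOn 0 ⟨le_rfl, hT.le⟩
    have h2 := Metric.continuousWithinAt_iff.1 h1 η hη
    obtain ⟨δ, hδ, h3⟩ := h2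
    refine ⟨δ / 2, by positivity, fun s hs hsδ => ?_⟩
    have h4 := h3 ⟨hs.1.le, hs.2⟩ (by
      rw [Real.dist_eq, sub_zero, abs_of_pos hs.1]
      linarith)
    rw [Real.dist_eq] at h4
    linarith [(abs_lt.1 h4).2, le_abs_self (w 0)]
  -- The extra `η` lets the comparison start on a short interval where `w` is close to `w 0`; the
  -- term `M * T ^ (1 - α) / μ₀` is the constant whose convolution balances the source `M` up to
  -- time `T`.
  have := hw.le_barrier (β := 0) (A := 0) (x := |w 0| + M * T ^ (1 - α) / μ₀ + η) hα0 hα1 one_pos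
    hδ (fun s hs => hμ₀.trans_le (hμ s hs)) (fun s hs hsδ => by linarith [hδw s hs hsδ])
    (fun s hs _ => by
      have h1 : T ^ (α - 1) ≤ s ^ (α - 1) :=
        Real.rpow_le_rpow_of_nonpos hs.1 hs.2 (by linarith)
      have h2 : μ₀ * (M * T ^ (1 - α) / μ₀) * T ^ (α - 1) = M := by
        rw [mul_div_cancel₀ _ hμ₀.ne', mul_assoc, ← Real.rpow_add hT]
        simp
      have h3 : μ₀ * (M * T ^ (1 - α) / μ₀) * T ^ (α - 1) ≤
          μ s * (|w 0| + M * T ^ (1 - α) / μ₀ + η) * s ^ (α - 1) := by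
        have := hμ s hs
        have := abs_nonneg (w 0)
        have hTα' : 0 ≤ T ^ (α - 1) := Real.rpow_nonneg hT.le _
        have := hμ₀.le.trans (hμ s hs)
        gcongr
        linarith
      linarith) t ht
  linarith

/-- The decay of the part of the solution that comes from the initial value. -/
theorem IsScalarSubsolution.le_decay {α β T M μ₀ : ℝ} {μ w : ℝ → ℝ}
    (hw : IsScalarSubsolution α T M μ w) (hα0 : 0 < α) (hα1 : α < 1) (hβ0 : 0 < β) (hβα : β < α)
    (hM : 0 ≤ M) (hμ₀ : 0 < μ₀) (hμ : ∀ t ∈ Set.Ioc 0 T, μ₀ ≤ μ t) :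
    ∀ t ∈ Set.Ioc 0 T, w t ≤ M * T ^ (1 - α) / μ₀ +
      |w 0| * (β / (μ₀ * powerConvRpow α β * (α - β))) ^ (β / α) * t ^ (-β) := by
  intro t ht
  have hT : 0 < T := ht.1.trans_le ht.2
  have hβ1 : β < 1 := hβα.trans hα1
  have hB := powerConvRpow_pos hα0 hβ1
  have hαβ : 0 < α - β := sub_pos.2 hβα
  -- `D` is the value of `s ^ α` from which the gain `μ₀ * powerConvRpow α β * (α - β) * s ^ (α - β
  -- - 1)` dominates the loss `β * s ^ (-β - 1)`. Up to `s = D ^ (1 / α)` one has `D ^ (β / α) * s ^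
  -- (-β) ≥ 1`, and `le_const` is enough.
  set D : ℝ := β / (μ₀ * powerConvRpow α β * (α - β)) with hD
  have hD0 : 0 < D := by positivity
  have hDβ : 0 < D ^ (β / α) := Real.rpow_pos_of_pos hD0 _
  have hA : 0 ≤ |w 0| * D ^ (β / α) := by positivity
  refine hw.le_barrier (δ := D ^ (1 / α)) hα0 hα1 hβ1 (Real.rpow_pos_of_pos hD0 _)
    (fun s hs => hμ₀.trans_le (hμ s hs)) ?_ ?_ t ht
  · intro s hs hsδ
    have h1 := hw.le_const hα0 hα1 hM hμ₀ hμ s hs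
    have h2 : s ^ β ≤ D ^ (β / α) := by
      have := Real.rpow_le_rpow hs.1.le hsδ hβ0.le
      rwa [← Real.rpow_mul hD0.le, one_div_mul_eq_div] at this
    have h3 : 1 ≤ D ^ (β / α) * s ^ (-β) := by
      rw [Real.rpow_neg hs.1.le, ← div_eq_mul_inv, one_le_div (Real.rpow_pos_of_pos hs.1 _)]
      exact h2
    have h4 := mul_le_mul_of_nonneg_left h3 (abs_nonneg (w 0))
    rw [mul_one, ← mul_assoc] at h4
    linarith
  · intro s hs hδs
    have hμs := hμ s hs
    have hμs0 : 0 < μ s := hμ₀.trans_le hμs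
    have h1 : T ^ (α - 1) ≤ s ^ (α - 1) :=
      Real.rpow_le_rpow_of_nonpos hs.1 hs.2 (by linarith)
    have h2 : μ₀ * (M * T ^ (1 - α) / μ₀) * T ^ (α - 1) = M := by
      rw [mul_div_cancel₀ _ hμ₀.ne', mul_assoc, ← Real.rpow_add hT]
      simp
    have h3 : μ₀ * (M * T ^ (1 - α) / μ₀) * T ^ (α - 1) ≤
        μ s * (M * T ^ (1 - α) / μ₀) * s ^ (α - 1) := by
      have hTα' : 0 ≤ T ^ (α - 1) := Real.rpow_nonneg hT.le _
      have hTα : 0 ≤ T ^ (1 - α) := Real.rpow_nonneg hT.le _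
      gcongr
    have h4 : D ≤ s ^ α := by
      have := Real.rpow_le_rpow (Real.rpow_nonneg hD0.le _) hδs.le hα0.le
      rwa [← Real.rpow_mul hD0.le, one_div_mul_cancel hα0.ne', Real.rpow_one] at this
    have h5 : β ≤ μ s * powerConvRpow α β * (α - β) * s ^ α := by
      calc β = μ₀ * powerConvRpow α β * (α - β) * D := by rw [hD]; field_simp
        _ ≤ _ := by gcongr
    have h6 : s ^ (α - β - 1) = s ^ α * s ^ (-β - 1) := by
      rw [← Real.rpow_add hs.1]
      congr 1
      ring
    have h7 : 0 ≤ s ^ (-β - 1) := Real.rpow_nonneg hs.1.le _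
    have h8 : 0 ≤ |w 0| * D ^ (β / α) * s ^ (-β - 1) *
        (μ s * powerConvRpow α β * (α - β) * s ^ α - β) :=
      mul_nonneg (mul_nonneg hA h7) (sub_nonneg.2 h5)
    rw [h6]
    linarith

/-! ### Reduction of a single mode to a scalar subsolution -/

/-- Replacing `b s` by `b t` on `[t - h, t]` costs at most `lam * |L| * h * ∫ |g|`, and the integral
of `|g|` over `[t - h, t]` tends to `0` with `h`. The error is thus `o(h)` and `L` leaves no trace
in the bound. -/
theorem isScalarSubsolution_of_integral_eq {α T M lam L : ℝ} {b w g F : ℝ → ℝ}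
    (hw : ContinuousOn w (Set.Icc 0 T)) (hlam : 0 ≤ lam)
    (hb : ∀ t ∈ Set.Icc 0 T, ∀ s ∈ Set.Icc 0 T, |b t - b s| ≤ L * |t - s|)
    (hg : ∀ δ t : ℝ, 0 < δ → δ ≤ t → t ≤ T → IntervalIntegrable g volume δ t ∧
      (Real.Gamma α)⁻¹ * (powerConv α w t - powerConv α w δ) = ∫ s in δ..t, g s)
    (hF : ContinuousOn F (Set.Icc 0 T)) (hFM : ∀ t ∈ Set.Icc 0 T, F t ≤ M)
    (heq : ∀ δ t : ℝ, 0 < δ → δ ≤ t → t ≤ T →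
      w t - w δ = ∫ s in δ..t, (b s * (-(lam * g s)) + F s)) :
    IsScalarSubsolution α T M (fun t => lam * b t / Real.Gamma α) w := by
  refine ⟨hw, fun t ht η hη => ?_⟩
  have hbc : ContinuousOn b (Set.Icc 0 T) := by
    intro x hx
    rw [ContinuousWithinAt, tendsto_iff_dist_tendsto_zero]
    refine squeeze_zero' (Eventually.of_forall fun _ => dist_nonneg)
      (eventually_nhdsWithin_of_forall fun y hy => hb y hy x hx) ?_
    have : Tendsto (fun y : ℝ => L * |y - x|) (𝓝 x) (𝓝 (L * |x - x|)) :=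
      (by fun_prop : Continuous fun y : ℝ => L * |y - x|).tendsto x
    rw [sub_self, abs_zero, mul_zero] at this
    exact this.mono_left nhdsWithin_le_nhds
  -- Integrability of `g` is available only away from `0`.
  have ht2 : 0 < t / 2 := half_pos ht.1
  have hgabs : IntervalIntegrable (fun s => |g s|) volume (t / 2) t :=
    (hg (t / 2) t ht2 (by linarith) ht.2).1.abs
  have hlim : Tendsto (fun h : ℝ => lam * (|L| * ∫ s in (t - h)..t, |g s|)) (𝓝[>] 0) (𝓝 0) := by
    have h1 := intervalIntegral.continuousOn_primitive_interval' hgabs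
      (Set.right_mem_uIcc (a := t / 2) (b := t)) t Set.right_mem_uIcc
    rw [Set.uIcc_of_le (by linarith)] at h1
    have h2 : Tendsto (fun h : ℝ => t - h) (𝓝[>] 0) (𝓝[Set.Icc (t / 2) t] t) := by
      refine tendsto_nhdsWithin_iff.2 ⟨?_, ?_⟩
      · refine tendsto_nhdsWithin_of_tendsto_nhds ?_
        have : Tendsto (fun s : ℝ => t - s) (𝓝 0) (𝓝 (t - 0)) :=
          (by fun_prop : Continuous _).tendsto 0
        rwa [sub_zero] at this
      · filter_upwards [Ioo_mem_nhdsGT ht2] with h hh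
        exact ⟨by linarith [hh.2], by linarith [hh.1]⟩
    have h3 := ((h1.tendsto.comp h2).neg.const_mul |L|).const_mul lam
    simp only [intervalIntegral.integral_same, neg_zero, mul_zero] at h3
    refine h3.congr fun h => ?_
    simp only [Function.comp_apply, intervalIntegral.integral_symm t (t - h)]
  have hsmall : ∀ᶠ h in 𝓝[>] (0 : ℝ), lam * (|L| * ∫ s in (t - h)..t, |g s|) < η :=
    hlim.eventually (gt_mem_nhds hη)
  filter_upwards [hsmall, Ioo_mem_nhdsGT ht2] with h hη hh
  have hδ0 : 0 < t - h := by linarith [hh.2]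
  have hδt : t - h ≤ t := by linarith [hh.1]
  have hsubI : Set.Icc (t - h) t ⊆ Set.Icc 0 T := Set.Icc_subset_Icc hδ0.le ht.2
  obtain ⟨hgi, hgU⟩ := hg (t - h) t hδ0 hδt ht.2
  have hFi : IntervalIntegrable F volume (t - h) t := by
    refine (hF.mono ?_).intervalIntegrable
    rwa [Set.uIcc_of_le hδt]
  have hbgi : IntervalIntegrable (fun s => (b t - b s) * g s) volume (t - h) t := by
    refine hgi.continuousOn_mul ?_
    rw [Set.uIcc_of_le hδt]
    exact continuousOn_const.sub (hbc.mono hsubI)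
  have hsplit : w t - w (t - h) = -(lam * b t) * (∫ s in (t - h)..t, g s) +
      lam * (∫ s in (t - h)..t, (b t - b s) * g s) + ∫ s in (t - h)..t, F s := by
    rw [heq _ _ hδ0 hδt ht.2, ← intervalIntegral.integral_const_mul,
      ← intervalIntegral.integral_const_mul,
      ← intervalIntegral.integral_add (hgi.const_mul _) (hbgi.const_mul _),
      ← intervalIntegral.integral_add ((hgi.const_mul _).add (hbgi.const_mul _)) hFi]
    refine intervalIntegral.integral_congr fun s _ => ?_
    ring
  have hFle : ∫ s in (t - h)..t, F s ≤ M * h := by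
    have := intervalIntegral.integral_mono_on hδt hFi
      (intervalIntegrable_const (c := M)) fun s hs => hFM s (hsubI hs)
    rw [intervalIntegral.integral_const, sub_sub_cancel, smul_eq_mul] at this
    linarith
  have hrem : ∫ s in (t - h)..t, (b t - b s) * g s ≤ |L| * h * ∫ s in (t - h)..t, |g s| := by
    rw [← intervalIntegral.integral_const_mul]
    refine intervalIntegral.integral_mono_on hδt hbgi (hgi.abs.const_mul _) fun s hs => ?_
    refine (le_abs_self _).trans ?_
    rw [abs_mul]
    refine mul_le_mul_of_nonneg_right ?_ (abs_nonneg _)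
    refine (hb t ⟨ht.1.le, ht.2⟩ s (hsubI hs)).trans ?_
    refine (mul_le_mul_of_nonneg_right (le_abs_self L) (abs_nonneg _)).trans ?_
    refine mul_le_mul_of_nonneg_left ?_ (abs_nonneg _)
    rw [abs_of_nonneg (by linarith [hs.2])]
    linarith [hs.1]
  have h1 := mul_le_mul_of_nonneg_left hrem hlam
  have h2 := mul_le_mul_of_nonneg_right hη.le hh.1.le
  rw [hsplit, ← hgU]
  have h3 : lam * b t / Real.Gamma α * (powerConv α w t - powerConv α w (t - h)) =
    lam * (b t * ((Real.Gamma α)⁻¹ * (powerConv α w t - powerConv α w (t - h)))) := by ring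
  rw [h3]
  linarith

/-- Pointwise decay for a single mode of the fractional equation. -/
theorem abs_le_of_integral_eq {α β T M lam L b₀ : ℝ} {b w g F : ℝ → ℝ}
    (hα0 : 0 < α) (hα1 : α < 1) (hβ0 : 0 < β) (hβα : β < α)
    (hw : ContinuousOn w (Set.Icc 0 T)) (hlam : 0 < lam) (hb₀ : 0 < b₀)
    (hbb : ∀ t ∈ Set.Icc 0 T, b₀ ≤ b t)
    (hb : ∀ t ∈ Set.Icc 0 T, ∀ s ∈ Set.Icc 0 T, |b t - b s| ≤ L * |t - s|)
    (hg : ∀ δ t : ℝ, 0 < δ → δ ≤ t → t ≤ T → IntervalIntegrable g volume δ t ∧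
      (Real.Gamma α)⁻¹ * (powerConv α w t - powerConv α w δ) = ∫ s in δ..t, g s)
    (hF : ContinuousOn F (Set.Icc 0 T)) (hFM : ∀ t ∈ Set.Icc 0 T, |F t| ≤ M)
    (heq : ∀ δ t : ℝ, 0 < δ → δ ≤ t → t ≤ T →
      w t - w δ = ∫ s in δ..t, (b s * (-(lam * g s)) + F s)) :
    ∀ t ∈ Set.Ioc 0 T, |w t| ≤ M * T ^ (1 - α) / (lam * b₀ / Real.Gamma α) +
      |w 0| * (β / (lam * b₀ / Real.Gamma α * powerConvRpow α β * (α - β))) ^ (β / α) *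
        t ^ (-β) := by
  intro t ht
  have hT : 0 < T := ht.1.trans_le ht.2
  have hΓ := Real.Gamma_pos_of_pos hα0
  have hM : 0 ≤ M := (abs_nonneg _).trans (hFM 0 ⟨le_rfl, hT.le⟩)
  have hμ : ∀ s ∈ Set.Ioc 0 T, lam * b₀ / Real.Gamma α ≤ lam * b s / Real.Gamma α := by
    intro s hs
    have := hbb s ⟨hs.1.le, hs.2⟩
    gcongr
  have h1 := (isScalarSubsolution_of_integral_eq hw hlam.le hb hg hF
    (fun s hs => (le_abs_self _).trans (hFM s hs)) heq).le_decay hα0 hα1 hβ0 hβα hM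
    (by positivity) hμ t ht
  have hneg : ∀ s, powerConv α (fun ξ => -w ξ) s = -powerConv α w s := by
    intro s
    simp only [powerConv, mul_neg, intervalIntegral.integral_neg]
  -- By linearity `-w` solves the same equation with source `-F`, which gives the lower bound.
  have h2 := (isScalarSubsolution_of_integral_eq (w := fun s => -w s) (g := fun s => -g s)
    (F := fun s => -F s) hw.neg hlam.le hb
    (fun δ t h0 h1 h2 => ⟨(hg δ t h0 h1 h2).1.neg, by
      rw [hneg, hneg, intervalIntegral.integral_neg, ← (hg δ t h0 h1 h2).2]
      ring⟩) hF.neg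
    (fun s hs => (neg_le_abs _).trans (hFM s hs))
    (fun δ t h0 h1 h2 => by
      rw [← neg_sub', heq δ t h0 h1 h2, ← intervalIntegral.integral_neg]
      refine intervalIntegral.integral_congr fun s _ => ?_
      ring)).le_decay hα0 hα1 hβ0 hβα hM
    (by positivity) hμ t ht
  rw [abs_neg] at h2
  exact abs_le.2 ⟨by linarith, h1⟩

/-! ### Orthonormality of the Dirichlet eigenfunctions -/

theorem continuous_eigenfunction (l r : ℝ) (j : ℕ) : Continuous (eigenfunction l r j) := by
  unfold eigenfunction
  fun_prop

theorem memLp_eigenfunction (l r : ℝ) (j : ℕ) :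
    MemLp (eigenfunction l r j) 2 (volume.restrict (Set.Ioo l r)) := by
  refine MemLp.of_bound (continuous_eigenfunction l r j).aestronglyMeasurable
    (Real.sqrt (2 / (r - l))) (Eventually.of_forall fun x => ?_)
  rw [eigenfunction, norm_mul, Real.norm_of_nonneg (Real.sqrt_nonneg _)]
  exact mul_le_of_le_one_right (Real.sqrt_nonneg _) (Real.abs_sin_le_one _)

/-- The eigenfunctions as elements of `L²(Ω)`. -/
noncomputable def eigenvec (l r : ℝ) (j : ℕ) : L2 l r :=
  (memLp_eigenfunction l r j).toLp (eigenfunction l r j)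

theorem pairing_eigenfunction {l r : ℝ} (v : L2 l r) (j : ℕ) :
    pairing v (eigenfunction l r j) = inner ℝ (eigenvec l r j) v := by
  rw [pairing, L2.inner_def]
  refine integral_congr_ae ?_
  filter_upwards [(memLp_eigenfunction l r j).coeFn_toLp] with x hx
  rw [eigenvec, hx]
  rfl

theorem pairing_neg_const_mul {l r : ℝ} (v : L2 l r) (k : ℝ) (g : ℝ → ℝ) :
    pairing v (fun x => -(k * g x)) = -(k * pairing v g) := by
  rw [pairing, pairing, ← integral_const_mul, ← integral_neg]
  refine integral_congr_ae (Eventually.of_forall fun x => ?_)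
  ring

theorem deriv_deriv_eigenfunction (l r : ℝ) (j : ℕ) :
    deriv (deriv (eigenfunction l r j)) =
      fun x => -(eigenvalue l r j * eigenfunction l r j x) := by
  funext x
  exact deriv_deriv_sinusoid _ _ l x

theorem integral_sin_mul_sin_eq_zero {l r p q : ℝ} (hlr : l ≤ r) (hpq : p ^ 2 ≠ q ^ 2)
    (hp : Real.sin (p * (r - l)) = 0) (hq : Real.sin (q * (r - l)) = 0) :
    ∫ x in Set.Ioo l r, Real.sin (p * (x - l)) * Real.sin (q * (x - l)) = 0 := by
  rw [← integral_Ioc_eq_integral_Ioo, ← intervalIntegral.integral_of_le hlr]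
  have hθ : ∀ k x : ℝ, HasDerivAt (fun x : ℝ => k * (x - l)) k x := fun k x => by
    simpa using ((hasDerivAt_id x).sub_const l).const_mul k
  have hder : ∀ x ∈ Set.uIcc l r, HasDerivAt (fun x => (p ^ 2 - q ^ 2)⁻¹ *
      (q * (Real.sin (p * (x - l)) * Real.cos (q * (x - l))) -
        p * (Real.cos (p * (x - l)) * Real.sin (q * (x - l)))))
      (Real.sin (p * (x - l)) * Real.sin (q * (x - l))) x := by
    intro x _
    have h := ((((hθ p x).sin.mul (hθ q x).cos).const_mul q).sub
      (((hθ p x).cos.mul (hθ q x).sin).const_mul p)).const_mul (p ^ 2 - q ^ 2)⁻¹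
    refine h.congr_deriv ?_
    have := sub_ne_zero.2 hpq
    field_simp
    ring
  rw [intervalIntegral.integral_eq_sub_of_hasDerivAt hder
    ((by fun_prop : Continuous _).intervalIntegrable _ _)]
  simp [hp, hq]

theorem orthonormal_eigenvec {l r : ℝ} (hlr : l < r) : Orthonormal ℝ (eigenvec l r) := by
  have hd : 0 < r - l := sub_pos.2 hlr
  have hinner : ∀ i j, inner ℝ (eigenvec l r i) (eigenvec l r j) =
      ∫ x in Set.Ioo l r, eigenfunction l r i x * eigenfunction l r j x := by
    intro i j
    rw [← pairing_eigenfunction, pairing]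
    refine integral_congr_ae ?_
    filter_upwards [(memLp_eigenfunction l r j).coeFn_toLp] with x hx
    rw [eigenvec, hx, mul_comm]
  rw [orthonormal_iff_ite]
  intro i j
  rw [hinner]
  split_ifs with hij
  · subst hij
    simpa only [sq] using (isNormalizedDirichletEigenpair_eigenfunction hlr i).normalized
  · have hs : ∀ k : ℕ, Real.sin (((k : ℝ) + 1) * Real.pi / (r - l) * (r - l)) = 0 := by
      intro k
      rw [div_mul_cancel₀ _ hd.ne']
      exact_mod_cast Real.sin_nat_mul_pi (k + 1)
    have hne : (((i : ℝ) + 1) * Real.pi / (r - l)) ^ 2 ≠ (((j : ℝ) + 1) * Real.pi / (r - l)) ^ 2 := by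
      intro h
      have h1 := (pow_left_inj₀ (by positivity) (by positivity) two_ne_zero).1 h
      have h2 := mul_right_cancel₀ Real.pi_ne_zero ((div_left_inj' hd.ne').1 h1)
      exact hij (by exact_mod_cast add_right_cancel h2)
    simp only [eigenfunction]
    refine (integral_congr_ae (Eventually.of_forall fun x => mul_mul_mul_comm _ _ _ _)).trans ?_
    rw [integral_const_mul, integral_sin_mul_sin_eq_zero hlr.le hne (hs i) (hs j), mul_zero]

theorem eigenvalue_pos {l r : ℝ} (hlr : l < r) (j : ℕ) : 0 < eigenvalue l r j := by
  have hd : 0 < r - l := sub_pos.2 hlr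
  unfold eigenvalue
  positivity

theorem eigenvalue_zero_le {l r : ℝ} (hlr : l < r) (j : ℕ) :
    eigenvalue l r 0 ≤ eigenvalue l r j := by
  have hd : 0 < r - l := sub_pos.2 hlr
  unfold eigenvalue
  have : (0 : ℝ) ≤ j := j.cast_nonneg
  gcongr
  simp

/-! ### Projection of the equation onto the modes -/

/-- Minkowski's integral inequality, combined with Bessel's inequality. -/
theorem sum_integral_abs_inner_sq_le {E ι : Type*} [NormedAddCommGroup E] [InnerProductSpace ℝ E]
    [CompleteSpace E] {e : ι → E} (he : Orthonormal ℝ e) {f : ℝ → E} {a b : ℝ} (hab : a ≤ b)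
    (hf : IntervalIntegrable f volume a b) (S : Finset ι) :
    ∑ i ∈ S, (∫ s in a..b, |inner ℝ (e i) (f s)|) ^ 2 ≤ (∫ s in a..b, ‖f s‖) ^ 2 := by
  set c : ι → ℝ := fun i => ∫ s in a..b, |inner ℝ (e i) (f s)| with hc
  have hint : ∀ i, IntervalIntegrable (fun s => |inner ℝ (e i) (f s)|) volume a b := fun i =>
    IntervalIntegrable.abs ⟨(innerSL ℝ (e i)).integrable_comp hf.1,
      (innerSL ℝ (e i)).integrable_comp hf.2⟩
  set R : ℝ := Real.sqrt (∑ i ∈ S, c i ^ 2) with hR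
  have hsum : 0 ≤ ∑ i ∈ S, c i ^ 2 := Finset.sum_nonneg fun i _ => sq_nonneg _
  have hR2 : R ^ 2 = ∑ i ∈ S, c i ^ 2 := Real.sq_sqrt hsum
  have hJ : 0 ≤ ∫ s in a..b, ‖f s‖ :=
    intervalIntegral.integral_nonneg hab fun _ _ => norm_nonneg _
  -- Duality: the vector of integrals is paired with itself, then Cauchy–Schwarz and Bessel are used
  -- pointwise under the integral.
  have hpt : ∀ s, ∑ i ∈ S, c i * |inner ℝ (e i) (f s)| ≤ R * ‖f s‖ := by
    intro s
    have h1 := Finset.sum_mul_sq_le_sq_mul_sq S c (fun i => |inner ℝ (e i) (f s)|)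
    have h2 : ∑ i ∈ S, |inner ℝ (e i) (f s)| ^ 2 ≤ ‖f s‖ ^ 2 := he.sum_inner_products_le (f s)
    refine abs_le_of_sq_le_sq' ?_ (by positivity) |>.2
    rw [mul_pow, hR2]
    exact h1.trans (mul_le_mul_of_nonneg_left h2 hsum)
  have h1 : R ^ 2 ≤ R * ∫ s in a..b, ‖f s‖ := by
    calc R ^ 2 = ∑ i ∈ S, ∫ s in a..b, c i * |inner ℝ (e i) (f s)| := by
          rw [hR2]
          refine Finset.sum_congr rfl fun i _ => ?_
          rw [intervalIntegral.integral_const_mul, sq]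
      _ = ∫ s in a..b, ∑ i ∈ S, c i * |inner ℝ (e i) (f s)| :=
          (intervalIntegral.integral_finsetSum fun i _ => (hint i).const_mul _).symm
      _ ≤ ∫ s in a..b, R * ‖f s‖ :=
          intervalIntegral.integral_mono_on hab
            (by simpa only [Finset.sum_fn] using
              IntervalIntegrable.sum S fun i _ => (hint i).const_mul (c i))
            (hf.norm.const_mul R) fun s _ => hpt s
      _ = R * ∫ s in a..b, ‖f s‖ := intervalIntegral.integral_const_mul _ _
  rw [← hR2]
  have hR0 : 0 ≤ R := Real.sqrt_nonneg _
  refine pow_le_pow_left₀ hR0 ?_ 2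
  rcases hR0.eq_or_lt with h0 | h0
  · rw [← h0]
    exact hJ
  · rw [sq] at h1
    exact le_of_mul_le_mul_left h1 h0

theorem inner_rlIntegral {l r α t : ℝ} (hα : 0 < α) (ht : 0 ≤ t) {W : ℝ → L2 l r}
    (hW : ContinuousOn W (Set.Icc 0 t)) (u : L2 l r) :
    inner ℝ u (rlIntegral α W t) =
      (Real.Gamma α)⁻¹ * powerConv α (fun s => inner ℝ u (W s)) t := by
  have hint : IntervalIntegrable (fun ξ => (t - ξ) ^ (α - 1) • W ξ) volume 0 t :=
    (intervalIntegrable_sub_rpow hα t 0 t).smul_continuousOn (by rwa [Set.uIcc_of_le ht])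
  rw [rlIntegral, real_inner_smul_right, powerConv]
  congr 1
  have := (innerSL ℝ u).intervalIntegral_comp_comm hint
  simp only [innerSL_apply_apply, real_inner_smul_right] at this
  exact this.symm

theorem inner_intervalIntegral {E : Type*} [NormedAddCommGroup E] [InnerProductSpace ℝ E]
    [CompleteSpace E] {f : ℝ → E} {a b : ℝ} (hf : IntervalIntegrable f volume a b) (u : E) :
    inner ℝ u (∫ s in a..b, f s) = ∫ s in a..b, inner ℝ u (f s) :=
  ((innerSL ℝ u).intervalIntegral_comp_comm hf).symm

theorem intervalIntegrable_inner {E : Type*} [NormedAddCommGroup E] [InnerProductSpace ℝ E]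
    {f : ℝ → E} {a b : ℝ} (hf : IntervalIntegrable f volume a b) (u : E) :
    IntervalIntegrable (fun s => inner ℝ u (f s)) volume a b :=
  ⟨(innerSL ℝ u).integrable_comp hf.1, (innerSL ℝ u).integrable_comp hf.2⟩

/-- Every mode of a solution decays like the corresponding barrier. -/
theorem IsSolution.abs_inner_eigenvec_le {l r α β T C L : ℝ} (hlr : l < r) (hα0 : 0 < α)
    (hα1 : α < 1) (hβ0 : 0 < β) (hβα : β < α) (hC : 0 < C) {a : ℝ → ℝ}
    (hL : ∀ t ∈ Set.Icc 0 T, ∀ s ∈ Set.Icc 0 T, |1 / a t ^ 2 - 1 / a s ^ 2| ≤ L * |t - s|)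
    (ha : ∀ t ∈ Set.Icc 0 T, 0 < a t ^ 2 ∧ a t ^ 2 < C) {W₀ : L2 l r} {f f' W : ℝ → L2 l r}
    (hf' : IntervalIntegrable f' volume 0 T)
    (hf : ∀ t ∈ Set.Icc 0 T, f t = f 0 + ∫ s in (0 : ℝ)..t, f' s)
    (hW : IsSolution α T a W₀ f W) (j : ℕ) {t : ℝ} (ht : t ∈ Set.Ioc 0 T) :
    |inner ℝ (eigenvec l r j) (W t)| ≤
      (|inner ℝ (eigenvec l r j) (f 0)| + ∫ s in (0 : ℝ)..t, |inner ℝ (eigenvec l r j) (f' s)|) *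
          t ^ (1 - α) / (eigenvalue l r j * (1 / C) / Real.Gamma α) +
        |inner ℝ (eigenvec l r j) W₀| *
          (β / (eigenvalue l r j * (1 / C) / Real.Gamma α * powerConvRpow α β * (α - β))) ^
            (β / α) * t ^ (-β) := by
  obtain ⟨G, hG, heq⟩ := hW.equation
  set u := eigenvec l r j with hu
  have hT : 0 ≤ T := ht.1.le.trans ht.2
  have hsub : Set.Icc 0 t ⊆ Set.Icc 0 T := Set.Icc_subset_Icc le_rfl ht.2
  have hf't : ∀ s ∈ Set.Icc 0 t, IntervalIntegrable f' volume 0 s := fun s hs =>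
    hf'.mono_set (by
      rw [Set.uIcc_of_le hs.1, Set.uIcc_of_le hT]
      exact Set.Icc_subset_Icc le_rfl (hs.2.trans ht.2))
  have hFeq : ∀ s ∈ Set.Icc 0 t, inner ℝ u (f s) =
      inner ℝ u (f 0) + ∫ x in (0 : ℝ)..s, inner ℝ u (f' x) := by
    intro s hs
    rw [hf s (hsub hs), inner_add_right, inner_intervalIntegral (hf't s hs)]
  have hi : ∀ s ∈ Set.Icc 0 t, IntervalIntegrable (fun x => inner ℝ u (f' x)) volume 0 s :=
    fun s hs => intervalIntegrable_inner (hf't s hs) u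
  have htt : t ∈ Set.Icc 0 t := ⟨ht.1.le, le_rfl⟩
  -- Taking `t` as the final time keeps the source bound down to the integral of `f'` over `[0, t]`.
  have key := abs_le_of_integral_eq (T := t) (w := fun s => inner ℝ u (W s))
    (g := fun s => inner ℝ u (G s)) (F := fun s => inner ℝ u (f s)) (b := fun s => 1 / a s ^ 2)
    (M := |inner ℝ u (f 0)| + ∫ s in (0 : ℝ)..t, |inner ℝ u (f' s)|) (L := L)
    (lam := eigenvalue l r j) (b₀ := 1 / C) hα0 hα1 hβ0 hβα
    ((innerSL ℝ u).continuous.comp_continuousOn (hW.continuousOn.mono hsub))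
    (eigenvalue_pos hlr j) (one_div_pos.2 hC)
    (fun s hs => one_div_le_one_div_of_le (ha s (hsub hs)).1 (ha s (hsub hs)).2.le)
    (fun s hs s' hs' => hL s (hsub hs) s' (hsub hs')) ?_ ?_ ?_ ?_ t ⟨ht.1, le_rfl⟩
  · simpa only [hW.initial] using key
  · intro δ s hδ hδs hs
    obtain ⟨h1, h2⟩ := hG δ s hδ hδs (hs.trans ht.2)
    refine ⟨intervalIntegrable_inner h1 u, ?_⟩
    rw [mul_sub, ← inner_rlIntegral hα0 (hδ.le.trans hδs)
      (hW.continuousOn.mono (Set.Icc_subset_Icc le_rfl (hs.trans ht.2))),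
      ← inner_rlIntegral hα0 hδ.le
      (hW.continuousOn.mono (Set.Icc_subset_Icc le_rfl ((hδs.trans hs).trans ht.2))),
      ← inner_sub_right, h2, inner_intervalIntegral h1]
  · refine ContinuousOn.congr (continuousOn_const.add ?_) hFeq
    have := intervalIntegral.continuousOn_primitive_interval' (hi t htt) Set.left_mem_uIcc
    rwa [Set.uIcc_of_le ht.1.le] at this
  · intro s hs
    rw [hFeq s hs]
    refine (abs_add_le _ _).trans (add_le_add le_rfl ?_)
    refine (intervalIntegral.abs_integral_le_integral_abs hs.1).trans ?_
    exact intervalIntegral.integral_mono_interval le_rfl hs.1 hs.2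
      (Eventually.of_forall fun _ => abs_nonneg _) (hi t htt).abs
  · intro δ s hδ hδs hs
    -- The eigenfunction is an admissible test function, and its second derivative is `-λⱼ` times
    -- itself.
    have h := heq (eigenfunction l r j) (by unfold eigenfunction; fun_prop)
      (isNormalizedDirichletEigenpair_eigenfunction hlr j).left
      (isNormalizedDirichletEigenpair_eigenfunction hlr j).right δ s hδ hδs (hs.trans ht.2)
    simpa only [deriv_deriv_eigenfunction, pairing_neg_const_mul, pairing_eigenfunction] using h

/-- The decay of every mode, with a constant that does not depend on the mode. -/
theorem exists_eigenvalue_mul_abs_inner_eigenvec_le {l r α ε T : ℝ} (c C L : ℝ) (hlr : l < r)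
    (hα0 : 0 < α) (hα1 : α < 1) (hε : 0 < ε) (hT : 0 < T) (hc : 0 < c) (hC : 0 < C) :
    ∃ K : ℝ, 0 < K ∧ ∀ a : ℝ → ℝ,
      (∀ t ∈ Set.Icc 0 T, ∀ s ∈ Set.Icc 0 T, |1 / a t ^ 2 - 1 / a s ^ 2| ≤ L * |t - s|) →
      (∀ t ∈ Set.Icc 0 T, c < a t ^ 2 ∧ a t ^ 2 < C) →
      ∀ (W₀ : L2 l r) (f f' W : ℝ → L2 l r), IntervalIntegrable f' volume 0 T →
      (∀ t ∈ Set.Icc 0 T, f t = f 0 + ∫ s in (0 : ℝ)..t, f' s) →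
      IsSolution α T a W₀ f W → ∀ t ∈ Set.Ioc 0 T, ∀ j,
      eigenvalue l r j * |inner ℝ (eigenvec l r j) (W t)| ≤
        K * (t ^ (-α) * (eigenvalue l r j ^ (ε / 2) * |inner ℝ (eigenvec l r j) W₀|) +
          |inner ℝ (eigenvec l r j) (f 0)| +
          ∫ s in (0 : ℝ)..t, |inner ℝ (eigenvec l r j) (f' s)|) := by
  -- Capping `ε` at `1` keeps `θ`, hence `β`, positive; the lost factor `λⱼ ^ ((ε' - ε) / 2)` is
  -- bounded by its value at the lowest eigenvalue.
  set ε' : ℝ := min ε 1 with hε'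
  have hε'0 : 0 < ε' := lt_min hε one_pos
  have hε'1 : ε' ≤ 1 := min_le_right _ _
  have hε'ε : ε' ≤ ε := min_le_left _ _
  set θ : ℝ := 1 - ε' / 2 with hθ
  have hθ0 : 0 < θ := by linarith
  -- Then `β / α = θ`, and `λⱼ * λⱼ ^ (-θ) = λⱼ ^ (ε' / 2)`.
  set β : ℝ := α * θ with hβ
  have hβ0 : 0 < β := by positivity
  have hβα : β < α := by nlinarith
  have hαβ : 0 < α - β := sub_pos.2 hβα
  have hΓ := Real.Gamma_pos_of_pos hα0
  have hB : 0 < powerConvRpow α β := powerConvRpow_pos hα0 (hβα.trans hα1)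
  set D : ℝ := β * (Real.Gamma α * C) / (powerConvRpow α β * (α - β)) with hD
  have hD0 : 0 < D := by positivity
  have hl0 := eigenvalue_pos hlr 0
  set K₁ : ℝ := D ^ θ * T ^ (α - β) * eigenvalue l r 0 ^ ((ε' - ε) / 2) with hK₁
  set K₂ : ℝ := T ^ (1 - α) * (Real.Gamma α * C) with hK₂
  have hK₁0 : 0 < K₁ := by
    have := Real.rpow_pos_of_pos hD0 θ
    have := Real.rpow_pos_of_pos hT (α - β)
    have := Real.rpow_pos_of_pos hl0 ((ε' - ε) / 2)
    positivity
  have hK₂0 : 0 < K₂ := by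
    have := Real.rpow_pos_of_pos hT (1 - α)
    positivity
  refine ⟨K₁ + K₂, by positivity, ?_⟩
  intro a hL ha W₀ f f' W hf' hf hW t ht j
  have hl := eigenvalue_pos hlr j
  have hll := eigenvalue_zero_le hlr j
  have h := hW.abs_inner_eigenvec_le hlr hα0 hα1 hβ0 hβα hC hL
    (fun s hs => ⟨hc.trans (ha s hs).1, (ha s hs).2⟩) hf' hf j ht
  set lam := eigenvalue l r j with hlam
  set M : ℝ := |inner ℝ (eigenvec l r j) (f 0)| +
    ∫ s in (0 : ℝ)..t, |inner ℝ (eigenvec l r j) (f' s)| with hM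
  set x : ℝ := |inner ℝ (eigenvec l r j) W₀| with hx
  have hx0 : 0 ≤ x := abs_nonneg _
  have hM0 : 0 ≤ M := add_nonneg (abs_nonneg _)
    (intervalIntegral.integral_nonneg ht.1.le fun _ _ => abs_nonneg _)
  have e1 : lam * (M * t ^ (1 - α) / (lam * (1 / C) / Real.Gamma α)) =
      M * (t ^ (1 - α) * (Real.Gamma α * C)) := by
    field_simp
  have e2 : lam * (x * (β / (lam * (1 / C) / Real.Gamma α * powerConvRpow α β * (α - β))) ^
      (β / α) * t ^ (-β)) = D ^ θ * t ^ (α - β) * lam ^ ((ε' - ε) / 2) *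
        (t ^ (-α) * (lam ^ (ε / 2) * x)) := by
    have e3 : β / (lam * (1 / C) / Real.Gamma α * powerConvRpow α β * (α - β)) = D / lam := by
      rw [hD]
      field_simp
    have e4 : β / α = θ := by rw [hβ]; field_simp
    have e5 : lam * (D / lam) ^ θ = D ^ θ * (lam ^ ((ε' - ε) / 2) * lam ^ (ε / 2)) := by
      rw [← Real.rpow_add hl, Real.div_rpow hD0.le hl.le,
        show (ε' - ε) / 2 + ε / 2 = 1 - θ by rw [hθ]; ring, Real.rpow_sub hl 1 θ, Real.rpow_one]
      ring
    have e6 : t ^ (-β) = t ^ (α - β) * t ^ (-α) := by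
      rw [← Real.rpow_add ht.1]
      congr 1
      ring
    rw [e3, e4, e6]
    linear_combination x * t ^ (α - β) * t ^ (-α) * e5
  have h1 : t ^ (1 - α) ≤ T ^ (1 - α) := Real.rpow_le_rpow ht.1.le ht.2 (by linarith)
  have h2 : t ^ (α - β) ≤ T ^ (α - β) := Real.rpow_le_rpow ht.1.le ht.2 hαβ.le
  have h3 : lam ^ ((ε' - ε) / 2) ≤ eigenvalue l r 0 ^ ((ε' - ε) / 2) :=
    Real.rpow_le_rpow_of_nonpos hl0 hll (by linarith)
  have hX : 0 ≤ t ^ (-α) * (lam ^ (ε / 2) * x) :=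
    mul_nonneg (Real.rpow_nonneg ht.1.le _) (mul_nonneg (Real.rpow_nonneg hl.le _) hx0)
  have h4 : M * (t ^ (1 - α) * (Real.Gamma α * C)) ≤ K₂ * M := by
    rw [hK₂, mul_comm M]
    gcongr
  have h5 : D ^ θ * t ^ (α - β) * lam ^ ((ε' - ε) / 2) * (t ^ (-α) * (lam ^ (ε / 2) * x)) ≤
      K₁ * (t ^ (-α) * (lam ^ (ε / 2) * x)) := by
    refine mul_le_mul_of_nonneg_right ?_ hX
    have := Real.rpow_nonneg hD0.le θ
    have := Real.rpow_nonneg hl.le ((ε' - ε) / 2)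
    have := Real.rpow_nonneg hT.le (α - β)
    rw [hK₁]
    gcongr
  have h6 := mul_le_mul_of_nonneg_left h hl.le
  rw [mul_add, e1, e2] at h6
  have h7 : 0 ≤ K₁ * M := by positivity
  have h8 : 0 ≤ K₂ * (t ^ (-α) * (lam ^ (ε / 2) * x)) := by positivity
  calc lam * |inner ℝ (eigenvec l r j) (W t)|
      ≤ K₂ * M + K₁ * (t ^ (-α) * (lam ^ (ε / 2) * x)) := by linarith
    _ ≤ (K₁ + K₂) * (t ^ (-α) * (lam ^ (ε / 2) * x) + M) := by linarith
    _ = _ := by rw [hM, add_assoc]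

/-! ### Summation over the modes -/

/-- Membership in `Ḣ²`, with a bound for the norm, from a bound for all partial sums. -/
theorem mem_hDot_two_of_forall_sum_le {l r R : ℝ} {v : L2 l r} (hR : 0 ≤ R)
    (h : ∀ S : Finset ℕ, ∑ j ∈ S, (eigenvalue l r j * |inner ℝ (eigenvec l r j) v|) ^ 2 ≤ R ^ 2) :
    v ∈ HDot l r 2 ∧ hDotNorm 2 v ≤ R := by
  have hterm : ∀ j, eigenvalue l r j ^ (2 : ℝ) * pairing v (eigenfunction l r j) ^ 2 =
      (eigenvalue l r j * |inner ℝ (eigenvec l r j) v|) ^ 2 := by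
    intro j
    rw [pairing_eigenfunction, Real.rpow_two, mul_pow, sq_abs]
  simp only [HDot, hDotNorm, Set.mem_ofPred_eq, hterm]
  exact ⟨summable_of_sum_le (fun _ => sq_nonneg _) h,
    Real.sqrt_le_iff.2 ⟨hR, Real.tsum_le_of_sum_le (fun _ => sq_nonneg _) h⟩⟩

theorem sum_sq_le_hDotNorm_sq {l r ε : ℝ} (hlr : l < r) {v : L2 l r} (hv : v ∈ HDot l r ε)
    (S : Finset ℕ) :
    ∑ j ∈ S, (eigenvalue l r j ^ (ε / 2) * |inner ℝ (eigenvec l r j) v|) ^ 2 ≤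
      hDotNorm ε v ^ 2 := by
  have hterm : ∀ j, eigenvalue l r j ^ ε * pairing v (eigenfunction l r j) ^ 2 =
      (eigenvalue l r j ^ (ε / 2) * |inner ℝ (eigenvec l r j) v|) ^ 2 := by
    intro j
    rw [pairing_eigenfunction, mul_pow, sq_abs, ← Real.rpow_mul_natCast (eigenvalue_pos hlr j).le]
    congr 2
    push_cast
    ring
  simp only [HDot, Set.mem_ofPred_eq, hterm] at hv
  simp only [hDotNorm, hterm]
  rw [Real.sq_sqrt (tsum_nonneg fun _ => sq_nonneg _)]
  exact hv.sum_le_tsum S fun _ _ => sq_nonneg _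

end ExpandingMedia

theorem mainTheorem2 (l r : ℝ) (hlr : l < r) (α : ℝ) (hα0 : 0 < α) (hα1 : α < 1)
    (ε : ℝ) (hε : 0 < ε) (T : ℝ) (hT : 0 < T) (c C L : ℝ) (hc : 0 < c) :
    ∃ K : ℝ, 0 < K ∧
      ∀ a : ℝ → ℝ,
        (∀ t ∈ Set.Icc 0 T, ∀ s ∈ Set.Icc 0 T, |1 / a t ^ 2 - 1 / a s ^ 2| ≤ L * |t - s|) →
        (∀ t ∈ Set.Icc 0 T, c < a t ^ 2 ∧ a t ^ 2 < C) →
      ∀ (W₀ : ExpandingMedia.L2 l r) (f f' W : ℝ → ExpandingMedia.L2 l r),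
        W₀ ∈ ExpandingMedia.HDot l r ε →
        IntervalIntegrable f' MeasureTheory.volume 0 T →
        (∀ t ∈ Set.Icc 0 T, f t = f 0 + ∫ s in (0 : ℝ)..t, f' s) →
        ExpandingMedia.IsSolution α T a W₀ f W →
      ∀ t ∈ Set.Ioc 0 T,
        W t ∈ ExpandingMedia.HDot l r 2 ∧
          ExpandingMedia.hDotNorm 2 (W t) ≤
            K * (t ^ (-α) * ExpandingMedia.hDotNorm ε W₀ + ‖f 0‖ +
              ∫ s in (0 : ℝ)..t, ‖f' s‖) := by
  open ExpandingMedia in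
  -- For `C ≤ 0` no coefficient `a` is admissible.
  rcases le_or_gt C 0 with hC | hC
  · refine ⟨1, one_pos, fun a _ ha => ?_⟩
    have := ha 0 ⟨le_rfl, hT.le⟩
    linarith [this.1, this.2]
  obtain ⟨K, hK, hmode⟩ :=
    exists_eigenvalue_mul_abs_inner_eigenvec_le c C L hlr hα0 hα1 hε hT hc hC
  -- The square of a sum of three terms costs a factor `3`, and `3 * K ^ 2 ≤ (2 * K) ^ 2`.
  refine ⟨2 * K, by positivity, ?_⟩
  intro a hL ha W₀ f f' W hW₀ hf' hf hW t ht
  have hf't : IntervalIntegrable f' MeasureTheory.volume 0 t := hf'.mono_set (by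
    rw [Set.uIcc_of_le ht.1.le, Set.uIcc_of_le hT.le]
    exact Set.Icc_subset_Icc le_rfl ht.2)
  have htα : 0 ≤ t ^ (-α) := Real.rpow_nonneg ht.1.le _
  have hN : 0 ≤ hDotNorm ε W₀ := Real.sqrt_nonneg _
  have hJ : 0 ≤ ∫ s in (0 : ℝ)..t, ‖f' s‖ :=
    intervalIntegral.integral_nonneg ht.1.le fun _ _ => norm_nonneg _
  refine mem_hDot_two_of_forall_sum_le (by positivity) fun S => ?_
  set x : ℕ → ℝ := fun j => eigenvalue l r j ^ (ε / 2) * |inner ℝ (eigenvec l r j) W₀| with hx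
  set y : ℕ → ℝ := fun j => |inner ℝ (eigenvec l r j) (f 0)| with hy
  set z : ℕ → ℝ := fun j => ∫ s in (0 : ℝ)..t, |inner ℝ (eigenvec l r j) (f' s)| with hz
  have hxS : ∑ j ∈ S, x j ^ 2 ≤ hDotNorm ε W₀ ^ 2 := sum_sq_le_hDotNorm_sq hlr hW₀ S
  have hyS : ∑ j ∈ S, y j ^ 2 ≤ ‖f 0‖ ^ 2 := (orthonormal_eigenvec hlr).sum_inner_products_le _
  have hzS : ∑ j ∈ S, z j ^ 2 ≤ (∫ s in (0 : ℝ)..t, ‖f' s‖) ^ 2 :=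
    sum_integral_abs_inner_sq_le (orthonormal_eigenvec hlr) ht.1.le hf't S
  have hterm : ∀ j ∈ S, (eigenvalue l r j * |inner ℝ (eigenvec l r j) (W t)|) ^ 2 ≤
      3 * K ^ 2 * ((t ^ (-α)) ^ 2 * x j ^ 2 + y j ^ 2 + z j ^ 2) := by
    intro j _
    have h1 := hmode a hL ha W₀ f f' W hf' hf hW t ht j
    have h2 : 0 ≤ eigenvalue l r j * |inner ℝ (eigenvec l r j) (W t)| :=
      mul_nonneg (eigenvalue_pos hlr j).le (abs_nonneg _)
    have h3 : (t ^ (-α) * x j + y j + z j) ^ 2 ≤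
        3 * ((t ^ (-α)) ^ 2 * x j ^ 2 + y j ^ 2 + z j ^ 2) := by
      linarith [sq_nonneg (t ^ (-α) * x j - y j), sq_nonneg (t ^ (-α) * x j - z j),
        sq_nonneg (y j - z j)]
    calc _ ≤ (K * (t ^ (-α) * x j + y j + z j)) ^ 2 := pow_le_pow_left₀ h2 h1 2
      _ = K ^ 2 * (t ^ (-α) * x j + y j + z j) ^ 2 := by ring
      _ ≤ K ^ 2 * (3 * ((t ^ (-α)) ^ 2 * x j ^ 2 + y j ^ 2 + z j ^ 2)) := by gcongr
      _ = _ := by ring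
  calc _ ≤ ∑ j ∈ S, 3 * K ^ 2 * ((t ^ (-α)) ^ 2 * x j ^ 2 + y j ^ 2 + z j ^ 2) :=
        Finset.sum_le_sum hterm
    _ = 3 * K ^ 2 * ((t ^ (-α)) ^ 2 * ∑ j ∈ S, x j ^ 2 + ∑ j ∈ S, y j ^ 2 +
        ∑ j ∈ S, z j ^ 2) := by
        rw [← Finset.mul_sum, Finset.sum_add_distrib, Finset.sum_add_distrib, Finset.mul_sum]
    _ ≤ 3 * K ^ 2 * ((t ^ (-α)) ^ 2 * hDotNorm ε W₀ ^ 2 + ‖f 0‖ ^ 2 +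
        (∫ s in (0 : ℝ)..t, ‖f' s‖) ^ 2) := by gcongr
    _ ≤ (2 * K) ^ 2 * (t ^ (-α) * hDotNorm ε W₀ + ‖f 0‖ + ∫ s in (0 : ℝ)..t, ‖f' s‖) ^ 2 := by
        rw [mul_pow]
        gcongr
        · norm_num
        · have h1 := mul_nonneg (mul_nonneg htα hN) (norm_nonneg (f 0))
          have h2 := mul_nonneg (mul_nonneg htα hN) hJ
          have h3 := mul_nonneg (norm_nonneg (f 0)) hJ
          linarith
    _ = _ := by rw [← mul_pow]
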